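/- Let $\mathcal X$ be an infinite-dimensional, separable, unital $C^*$-algebra with unit $\mathfrak 1$, and let $\mathcal X^*$ be its dual space with the weak$^*$ topology. Let $$E=\{\rho\in\mathcal X^*:\ \rho(A^*A)\ge 0\ \text{ for all }A\in\mathcal X,\ \ \rho(\mathfrak 1)=1\}$$ be the state space of $\mathcal X$. Let $\mathbf{CK}(\mathcal X^*)$ be the set of all nonempty convex weak$^*$-compact subsets of $\mathcal X^*$, endowed with the weak$^*$-Hausdorff hypertopology, that is, the topology induced by the family of pseudometrics $$d_H^{(A)}(K,\tilde K)=\max\Big\{\max_{\sigma\in K}\min_{\tilde\sigma\in\tilde K}|(\sigma-\tilde\sigma)(A)|,\ \max_{\tilde\sigma\in\tilde K}\min_{\sigma\in K}|(\sigma-\tilde\sigma)(A)|\Big\},\qquad A\in\mathcal X .$$ Let $\mathbf{CK}(E)=\{K\in\mathbf{CK}(\mathcal X^*):K\subseteq E\}$ with the subspace topology, and let $\mathcal D(E)$ be the set of all $K\in\mathbf{CK}(E)$ whose set $\mathcal E(K)$ of extreme points is weak$^*$-dense in $K$, that is, $K=\overline{\mathcal E(K)}$. Then: 1. $\mathbf{CK}(E)$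 is compact and completely metrizable, that is, its topology is induced by a complete metric; 2. $\mathbf{CK}(E)$ is a hyperspace of $E$: the map $\rho\mapsto\{\rho\}$ from $E$, with the weak$^*$ topology, to $\mathbf{CK}(E)$ is a homeomorphism onto its image; 3. $\mathcal D(E)$ is a dense $G_\delta$ subset of $\mathbf{CK}(E)$. -/

import Mathlib

open Set
open scoped ComplexOrder

section

variable (X : Type*) [CStarAlgebra X]

/-- The real scalar multiplication on the dual space (a shortcut to the existing structure). -/
noncomputable instance WeakDual.realSMul : SMul ℝ (WeakDual ℂ X) :=
  Module.toDistribMulAction.toDistribSMul.toSMul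

/-- The state space of a unital C⋆-algebra: all positive normalized continuous linear functionals,
as a subset of the dual space with its weak⋆ topology. -/
def stateSpace : Set (WeakDual ℂ X) :=
  {ρ | (∀ A : X, 0 ≤ ρ (star A * A)) ∧ ρ 1 = 1}

/-- The nonempty convex weak⋆-compact subsets of the dual space. -/
structure ConvexWeakStarCompacts where
  carrier : Set (WeakDual ℂ X)
  nonempty : carrier.Nonempty
  convex : Convex ℝ carrier
  isCompact : IsCompact carrier

end

namespace ConvexWeakStarCompacts

variable {X : Type*} [CStarAlgebra X]

/-- The Hausdorff pseudometric associated with an element `A` of the algebra. -/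
noncomputable def pseudoDist (A : X) (K L : ConvexWeakStarCompacts X) : ℝ :=
  max (⨆ σ : K.carrier, ⨅ τ : L.carrier, ‖σ.1 A - τ.1 A‖)
    (⨆ τ : L.carrier, ⨅ σ : K.carrier, ‖σ.1 A - τ.1 A‖)

/-- The image of a convex weak⋆-compact set under the evaluation at `A`. -/
def evalImage (A : X) (K : ConvexWeakStarCompacts X) : TopologicalSpace.NonemptyCompacts ℂ where
  carrier := (fun σ : WeakDual ℂ X => σ A) '' K.carrier
  isCompact' := K.isCompact.image (WeakDual.eval_continuous A)
  nonempty' := K.nonempty.image _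

/-- Half of the formula for the Hausdorff distance of two nonempty compact sets. -/
theorem ofReal_iSup_iInf (A : X) (K L : ConvexWeakStarCompacts X) :
    ENNReal.ofReal (⨆ σ : K.carrier, ⨅ τ : L.carrier, ‖σ.1 A - τ.1 A‖) =
      ⨆ x ∈ (evalImage A K : Set ℂ), Metric.infEDist x (evalImage A L : Set ℂ) := by
  have : Nonempty K.carrier := K.nonempty.to_subtype
  have : Nonempty L.carrier := L.nonempty.to_subtype
  have hbdd : BddAbove (range fun σ : K.carrier => ⨅ τ : L.carrier, ‖σ.1 A - τ.1 A‖) := by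
    obtain ⟨τ₀, hτ₀⟩ := L.nonempty
    obtain ⟨C, hC⟩ := (evalImage A K).isCompact.isBounded.exists_norm_le
    refine ⟨C + ‖τ₀ A‖, ?_⟩
    rintro _ ⟨σ, rfl⟩
    refine (ciInf_le ⟨0, ?_⟩ (⟨τ₀, hτ₀⟩ : L.carrier)).trans ?_
    · rintro _ ⟨τ, rfl⟩
      exact norm_nonneg _
    · exact (norm_sub_le _ _).trans (by gcongr; exact hC _ ⟨σ.1, σ.2, rfl⟩)
  rw [ENNReal.ofReal_mono.map_ciSup_of_continuousAt ENNReal.continuous_ofReal.continuousAt hbdd]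
  simp only [evalImage, Metric.infEDist, TopologicalSpace.NonemptyCompacts.coe_mk,
    TopologicalSpace.Compacts.coe_mk, iSup_image, iInf_image, iSup_subtype]
  refine iSup_congr fun σ => iSup_congr fun hσ => ?_
  rw [ENNReal.ofReal_iInf, iInf_subtype]
  refine iInf_congr fun τ => iInf_congr fun hτ => ?_
  rw [edist_dist, dist_eq_norm]

/-- The pseudometric of `A` is the Hausdorff distance of the images under the evaluation at `A`. -/
theorem pseudoDist_eq (A : X) (K L : ConvexWeakStarCompacts X) :
    pseudoDist A K L = dist (evalImage A K) (evalImage A L) := by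
  have h0 : 0 ≤ pseudoDist A K L :=
    le_max_of_le_left (Real.iSup_nonneg fun σ => Real.iInf_nonneg fun τ => norm_nonneg _)
  have h1 := ofReal_iSup_iInf A K L
  have h2 := ofReal_iSup_iInf A L K
  simp only [norm_sub_rev (Subtype.val (_ : L.carrier) A)] at h2
  rw [Metric.NonemptyCompacts.dist_eq, Metric.hausdorffDist, Metric.hausdorffEDist, ← h1, ← h2,
    ← ENNReal.ofReal_mono.map_max]
  exact (ENNReal.toReal_ofReal h0).symm

/-- The Hausdorff pseudometric of `A`, as a pseudometric structure. -/
@[reducible] noncomputable def pseudoMetric (A : X) :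
    PseudoMetricSpace (ConvexWeakStarCompacts X) where
  dist := pseudoDist A
  dist_self K := by rw [pseudoDist_eq, dist_self]
  dist_comm K L := by rw [pseudoDist_eq, pseudoDist_eq, dist_comm]
  dist_triangle K L M := by simpa only [pseudoDist_eq] using dist_triangle _ _ _

/-- The weak⋆-Hausdorff hypertopology: the topology induced by the family of all Hausdorff
pseudometrics, that is, the coarsest one that is finer than each of their topologies. -/
noncomputable instance : TopologicalSpace (ConvexWeakStarCompacts X) :=
  ⨅ A : X, (pseudoMetric A).toUniformSpace.toTopologicalSpace

end ConvexWeakStarCompacts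

section

variable (X : Type*) [CStarAlgebra X]

/-- The nonempty convex weak⋆-compact subsets of the state space. As a subtype this
carries the restriction of the weak⋆-Hausdorff hypertopology. -/
abbrev StateCompacts : Type _ :=
  {K : ConvexWeakStarCompacts X // K.carrier ⊆ stateSpace X}

/-- The members whose set of extreme points is weak⋆-dense. -/
def denseExtremeBoundary : Set (StateCompacts X) :=
  {K | K.1.carrier = closure (K.1.carrier.extremePoints ℝ)}

/-- The map sending a state `ρ` to the singleton `{ρ}`. -/
def singletonState (ρ : stateSpace X) : StateCompacts X :=
  ⟨⟨{ρ.1}, singleton_nonempty _, convex_singleton _, isCompact_singleton⟩,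
    singleton_subset_iff.2 ρ.2⟩

end

/-! The state space `E` is weak⋆-compact, and metrizable because the algebra is separable. The
closed-convex-hull map `stateHull`, from nonempty compact subsets of `E` to `CK(E)`, is surjective.
It is continuous because evaluations commute with closed hulls and taking hulls in `ℂ` is
1-Lipschitz for the Hausdorff distance. Hence `CK(E)` is compact. By Hahn–Banach a member is
determined by its images under the evaluations at a dense sequence, so `CK(E)` embeds in a countable
product of metric spaces.

By Krein–Milman and Milman's converse, the closure of the extreme points of `K` is the smallest
compact `F` with hull `K`. So `K` lies outside `D(E)` exactly when some compact `F` has hull `K` and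
misses a point of `K`. Bounding the distance of that point to `F` below by `1/(n+1)` gives the
closed sets `farHulls`; the intersection of their complements is `D(E)`, a `Gδ`.

By Baire, each complement only has to be dense. Finite linearly independent sets of states are dense
among compact sets, because in infinite dimension `E` lies in no finite span. Take such an `F` close
to `K`: every point of its hull is within `r` of `F`. All points of `F` are extreme in its hull, so
any compact `G` with the same hull contains `F` and is at least as close. -/

section Milman

/-! ### Extreme points of closed convex hulls. -/

variable {V : Type*} [AddCommGroup V] [Module ℝ V] [TopologicalSpace V]
  [IsTopologicalAddGroup V] [ContinuousSMul ℝ V]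

theorem IsCompact.convexJoin {s t : Set V} (hs : IsCompact s) (ht : IsCompact t) :
    IsCompact (convexJoin ℝ s t) := by
  have h : IsCompact ((fun p : (V × V) × ℝ => (1 - p.2) • p.1.1 + p.2 • p.1.2) ''
      ((s ×ˢ t) ×ˢ Icc (0 : ℝ) 1)) :=
    ((hs.prod ht).prod isCompact_Icc).image (by fun_prop)
  convert h using 1
  ext x
  simp only [mem_convexJoin, segment_eq_image, mem_image, mem_prod, Prod.exists]
  constructor
  · rintro ⟨a, ha, b, hb, θ, hθ, rfl⟩
    exact ⟨a, b, θ, ⟨⟨ha, hb⟩, hθ⟩, rfl⟩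
  · rintro ⟨a, b, θ, ⟨⟨ha, hb⟩, hθ⟩, rfl⟩
    exact ⟨a, ha, b, hb, θ, hθ, rfl⟩

/-- The join of two compact convex sets is convex and compact, hence closed, and it contains both.
-/
theorem closure_convexHull_union_subset_convexJoin [T2Space V] {s t : Set V}
    (hs : IsCompact (closure (convexHull ℝ s))) (ht : IsCompact (closure (convexHull ℝ t)))
    (hs' : s.Nonempty) (ht' : t.Nonempty) :
    closure (convexHull ℝ (s ∪ t)) ⊆
      _root_.convexJoin ℝ (closure (convexHull ℝ s)) (closure (convexHull ℝ t)) := by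
  have hsc : Convex ℝ (closure (convexHull ℝ s)) := (convex_convexHull ℝ s).closure
  have htc : Convex ℝ (closure (convexHull ℝ t)) := (convex_convexHull ℝ t).closure
  refine closure_minimal (convexHull_min ?_ (hsc.convexJoin htc)) (hs.convexJoin ht).isClosed
  rw [← hsc.convexHull_union htc (hs'.mono ?_) (ht'.mono ?_)]
  · exact (union_subset_union ((subset_convexHull ℝ s).trans subset_closure)
      ((subset_convexHull ℝ t).trans subset_closure)).trans (subset_convexHull ℝ _)
  · exact (subset_convexHull ℝ s).trans subset_closure
  · exact (subset_convexHull ℝ t).trans subset_closure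

/-- An extreme point in the closed convex hull of a union lies in one of the closed convex hulls. -/
theorem mem_closure_convexHull_of_mem_union [T2Space V] {s t K : Set V} {e : V}
    (hK : IsCompact K) (hKc : Convex ℝ K) (hs : s ⊆ K) (ht : t ⊆ K) (he : e ∈ K.extremePoints ℝ)
    (hst : e ∈ closure (convexHull ℝ (s ∪ t))) :
    e ∈ closure (convexHull ℝ s) ∨ e ∈ closure (convexHull ℝ t) := by
  rcases s.eq_empty_or_nonempty with rfl | hs'
  · simpa using hst
  rcases t.eq_empty_or_nonempty with rfl | ht'
  · simp_all
  have hsK : closure (convexHull ℝ s) ⊆ K := closure_minimal (convexHull_min hs hKc) hK.isClosed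
  have htK : closure (convexHull ℝ t) ⊆ K := closure_minimal (convexHull_min ht hKc) hK.isClosed
  obtain ⟨a, ha, b, hb, hab⟩ := mem_convexJoin.1 (closure_convexHull_union_subset_convexJoin
    (hK.of_isClosed_subset isClosed_closure hsK) (hK.of_isClosed_subset isClosed_closure htK)
    hs' ht' hst)
  rcases (mem_extremePoints_iff_forall_segment.1 he).2 a (hsK ha) b (htK hb) hab with rfl | rfl
  · exact .inl ha
  · exact .inr hb

/-- Milman's converse of the Krein–Milman theorem: the extreme points of a compact closed convex
hull of a compact set belong to that set. -/
theorem extremePoints_closure_convexHull_subset [T2Space V] [LocallyConvexSpace ℝ V] {F : Set V}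
    (hF : IsCompact F) (hK : IsCompact (closure (convexHull ℝ F))) :
    (closure (convexHull ℝ F)).extremePoints ℝ ⊆ F := by
  intro e he
  by_contra heF
  have hFK : F ⊆ closure (convexHull ℝ F) := (subset_convexHull ℝ F).trans subset_closure
  -- Compactness induction on the second factor: the property passes to unions because `e` is
  -- extreme, and holds near each point of `F` by separation from `e`.
  have key : e ∉ closure (convexHull ℝ (F ∩ F)) := by
    refine hF.induction_on (p := fun s => e ∉ closure (convexHull ℝ (F ∩ s))) (by simp) ?_ ?_ ?_
    · intro s t hst ht hs
      exact ht (closure_mono (convexHull_mono (inter_subset_inter_right _ hst)) hs)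
    · intro s t hs ht hst
      rw [inter_union_distrib_left] at hst
      rcases mem_closure_convexHull_of_mem_union hK (convex_convexHull ℝ F).closure
        (inter_subset_left.trans hFK) (inter_subset_left.trans hFK) he hst with h | h
      exacts [hs h, ht h]
    · intro x hx
      have hxe : x ≠ e := fun h => heF (h ▸ hx)
      obtain ⟨f, hf⟩ := geometric_hahn_banach_point_point hxe
      refine ⟨{y | f y < (f x + f e) / 2},
        mem_nhdsWithin_of_mem_nhds ((isOpen_lt f.continuous continuous_const).mem_nhds ?_), ?_⟩
      · simp only [mem_ofPred_eq]; linarith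
      · intro h
        have : closure (convexHull ℝ (F ∩ {y | f y < (f x + f e) / 2})) ⊆
            {y | f y ≤ (f x + f e) / 2} :=
          closure_minimal (convexHull_min (fun y hy => mem_ofPred.2 (mem_ofPred.1 hy.2).le)
            (convex_halfSpace_le f.toLinearMap.isLinear _)) (isClosed_le f.continuous continuous_const)
        have := this h
        simp only [mem_ofPred_eq] at this
        linarith
  rw [inter_self] at key
  exact key he.1

/-- The members of a finite linearly independent set are extreme points of its convex hull. -/
theorem LinearIndepOn.subset_extremePoints_convexHull [T2Space V] [LocallyConvexSpace ℝ V]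
    {t : Set V} (ht : t.Finite) (hli : LinearIndepOn ℝ id t) :
    t ⊆ (convexHull ℝ t).extremePoints ℝ := by
  intro p hp
  by_contra hpe
  -- If `p` were not extreme, Krein–Milman would put it in the hull, hence in the span, of the other
  -- points.
  have hsub : (convexHull ℝ t).extremePoints ℝ ⊆ t \ {p} := fun x hx =>
    ⟨extremePoints_convexHull_subset hx, fun h => hpe (h ▸ hx)⟩
  have h : p ∈ closure (convexHull ℝ ((convexHull ℝ t).extremePoints ℝ)) := by
    rw [closure_convexHull_extremePoints (ht.isCompact_convexHull ℝ) (convex_convexHull ℝ t)]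
    exact subset_convexHull ℝ t hp
  have h2 : p ∈ convexHull ℝ (t \ {p}) := by
    have := closure_mono (convexHull_mono hsub) h
    rwa [(ht.sdiff.isClosed_convexHull ℝ).closure_eq] at this
  have h3 := convexHull_min Submodule.subset_span (Submodule.span ℝ (t \ {p})).convex h2
  have := (linearIndepOn_iff_notMem_span.1 hli) p hp
  rw [image_id] at this
  exact this h3

end Milman

/-! ### Convex hulls and the Hausdorff distance. -/

section ConvexHull

variable {W : Type*} [NormedAddCommGroup W] [NormedSpace ℝ W]

/-- A closed thickening of a convex set is convex, so once it contains `s` it contains the hull of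
`s`. -/
theorem infEDist_convexHull_le_hausdorffEDist {s t : Set W} {x : W} (hx : x ∈ convexHull ℝ s) :
    Metric.infEDist x (convexHull ℝ t) ≤ Metric.hausdorffEDist s t := by
  rcases eq_or_ne (Metric.hausdorffEDist s t) ⊤ with h | h
  · simp [h]
  have hs : s ⊆ Metric.cthickening (Metric.hausdorffEDist s t).toReal (convexHull ℝ t) := by
    intro y hy
    rw [Metric.mem_cthickening_iff, ENNReal.ofReal_toReal h]
    exact (Metric.infEDist_anti (subset_convexHull ℝ t)).trans
      (Metric.infEDist_le_hausdorffEDist_of_mem hy)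
  have := convexHull_min hs ((convex_convexHull ℝ t).cthickening _) hx
  rwa [Metric.mem_cthickening_iff, ENNReal.ofReal_toReal h] at this

theorem hausdorffEDist_convexHull_le (s t : Set W) :
    Metric.hausdorffEDist (convexHull ℝ s) (convexHull ℝ t) ≤ Metric.hausdorffEDist s t :=
  Metric.hausdorffEDist_le_of_infEDist (fun _ hx => infEDist_convexHull_le_hausdorffEDist hx)
    (fun _ hx => by
      rw [Metric.hausdorffEDist_comm]; exact infEDist_convexHull_le_hausdorffEDist hx)

/-- The closed convex hull of a nonempty compact set. -/
noncomputable def TopologicalSpace.NonemptyCompacts.closedHull [ProperSpace W]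
    (K : TopologicalSpace.NonemptyCompacts W) : TopologicalSpace.NonemptyCompacts W where
  carrier := closure (convexHull ℝ (K : Set W))
  isCompact' := (isBounded_convexHull.2 K.isCompact.isBounded).isCompact_closure
  nonempty' := (convexHull_nonempty_iff.2 K.nonempty).closure

theorem TopologicalSpace.NonemptyCompacts.lipschitzWith_closedHull [ProperSpace W] :
    LipschitzWith 1 (closedHull : TopologicalSpace.NonemptyCompacts W → _) := by
  intro K L
  rw [ENNReal.coe_one, one_mul]
  change Metric.hausdorffEDist (closure (convexHull ℝ (K : Set W)))
    (closure (convexHull ℝ (L : Set W))) ≤ Metric.hausdorffEDist (K : Set W) L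
  rw [Metric.hausdorffEDist_closure]
  exact hausdorffEDist_convexHull_le _ _

end ConvexHull

/-! ### Separation in the weak⋆ dual, and the state space. -/

section WeakDual

variable (X : Type*) [CStarAlgebra X]

/-- The real vector space structure whose scalar multiplication is `WeakDual.realSMul`. -/
noncomputable instance WeakDual.realModule : Module ℝ (WeakDual ℂ X) :=
  WeakDual.instModule' ℝ

instance WeakDual.instIsScalarTowerReal : IsScalarTower ℝ ℂ (WeakDual ℂ X) :=
  ⟨fun r z σ => DFunLike.ext _ _ fun A => smul_assoc r z (σ A)⟩

instance WeakDual.instLocallyConvexSpaceReal : LocallyConvexSpace ℝ (WeakDual ℂ X) :=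
  (WeakDual.withSeminorms ℂ X).toLocallyConvexSpace

variable {X}

/-- A weak⋆-closed convex set is separated from the points outside by evaluations. -/
theorem WeakDual.exists_re_lt_of_notMem {s : Set (WeakDual ℂ X)} (hs : Convex ℝ s)
    (hsc : IsClosed s) {ρ : WeakDual ℂ X} (hρ : ρ ∉ s) :
    ∃ (A : X) (u : ℝ), (∀ σ ∈ s, (σ A).re < u) ∧ u < (ρ A).re := by
  obtain ⟨f, u, h1, h2⟩ := RCLike.geometric_hahn_banach_closed_point (𝕜 := ℂ) hs hsc hρ
  obtain ⟨A, hA⟩ := LinearMap.dualEmbedding_surjective (topDualPairing ℂ X) f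
  have hA' : ∀ σ, f σ = σ A := fun σ => (DFunLike.congr_fun hA σ).symm
  exact ⟨A, u, fun σ hσ => by simpa [hA'] using h1 σ hσ, by simpa [hA'] using h2⟩

end WeakDual

section StateSpace

variable {X : Type*} [CStarAlgebra X]

theorem convex_stateSpace : Convex ℝ (stateSpace X) := by
  intro ρ hρ σ hσ a b ha hb hab
  refine ⟨fun A => ?_, ?_⟩
  · change 0 ≤ a • ρ (star A * A) + b • σ (star A * A)
    exact add_nonneg (smul_nonneg ha (hρ.1 A)) (smul_nonneg hb (hσ.1 A))
  · change a • ρ 1 + b • σ 1 = 1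
    rw [hρ.2, hσ.2, ← add_smul, hab, one_smul]

theorem isClosed_stateSpace : IsClosed (stateSpace X) := by
  have : stateSpace X = (⋂ A : X, {ρ | 0 ≤ ρ (star A * A)}) ∩ {ρ | ρ 1 = 1} := by
    ext; simp [stateSpace]
  rw [this]
  exact (isClosed_iInter fun A => isClosed_le continuous_const (WeakDual.eval_continuous _)).inter
    (isClosed_eq (WeakDual.eval_continuous _) continuous_const)

/-- Apply `ρ` to the positive elements `‖a‖ - a` and `a + ‖a‖`. -/
theorem im_eq_zero_and_abs_re_le_of_isSelfAdjoint {ρ : WeakDual ℂ X} (hρ : ρ ∈ stateSpace X)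
    {a : X} (ha : IsSelfAdjoint a) : (ρ a).im = 0 ∧ |(ρ a).re| ≤ ‖a‖ := by
  let _ := CStarAlgebra.spectralOrder X
  let _ := CStarAlgebra.spectralOrderedRing X
  have hpos : ∀ b : X, 0 ≤ b → 0 ≤ ρ b := by
    intro b hb
    obtain ⟨c, rfl⟩ := CStarAlgebra.nonneg_iff_eq_star_mul_self.1 hb
    exact hρ.1 c
  have hone : ρ (algebraMap ℝ X ‖a‖) = (‖a‖ : ℂ) := by
    rw [IsScalarTower.algebraMap_apply ℝ ℂ X, Algebra.algebraMap_eq_smul_one, map_smul, hρ.2]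
    simp
  have h1 := hpos _ (sub_nonneg.2 ha.le_algebraMap_norm_self)
  have h2 := hpos _ (sub_nonneg.2 ha.neg_algebraMap_norm_le_self)
  rw [map_sub, hone, Complex.nonneg_iff] at h1
  rw [map_sub, map_neg, hone, Complex.nonneg_iff] at h2
  simp only [Complex.sub_re, Complex.sub_im, Complex.ofReal_re, Complex.ofReal_im,
    Complex.neg_re] at h1 h2
  refine ⟨by linarith [h1.2], abs_le.2 ⟨?_, ?_⟩⟩ <;> linarith [h1.1, h2.1]

theorem norm_apply_le_of_isSelfAdjoint {ρ : WeakDual ℂ X} (hρ : ρ ∈ stateSpace X) {a : X}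
    (ha : IsSelfAdjoint a) : ‖ρ a‖ ≤ ‖a‖ := by
  obtain ⟨him, hre⟩ := im_eq_zero_and_abs_re_le_of_isSelfAdjoint hρ ha
  rwa [← Complex.abs_re_eq_norm.2 him]

/-- The crude constant 2, from real and imaginary parts, is enough for Banach–Alaoglu. -/
theorem norm_apply_le_two_mul {ρ : WeakDual ℂ X} (hρ : ρ ∈ stateSpace X) (a : X) :
    ‖ρ a‖ ≤ 2 * ‖a‖ := by
  have h := realPart_add_I_smul_imaginaryPart a
  calc ‖ρ a‖ = ‖ρ (realPart a : X) + Complex.I * ρ (imaginaryPart a : X)‖ := by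
        conv_lhs => rw [← h, map_add, map_smul, smul_eq_mul]
    _ ≤ ‖ρ (realPart a : X)‖ + ‖ρ (imaginaryPart a : X)‖ := by
        refine (norm_add_le _ _).trans ?_
        rw [norm_mul, Complex.norm_I, one_mul]
    _ ≤ ‖(realPart a : X)‖ + ‖(imaginaryPart a : X)‖ :=
        add_le_add (norm_apply_le_of_isSelfAdjoint hρ (realPart a).2)
          (norm_apply_le_of_isSelfAdjoint hρ (imaginaryPart a).2)
    _ ≤ ‖a‖ + ‖a‖ := add_le_add (realPart.norm_le a) (imaginaryPart.norm_le a)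
    _ = 2 * ‖a‖ := (two_mul _).symm

theorem isCompact_stateSpace : IsCompact (stateSpace X) := by
  refine (WeakDual.isCompact_closedBall (𝕜 := ℂ) (E := X) 0 2).of_isClosed_subset
    isClosed_stateSpace fun ρ hρ => ?_
  rw [mem_preimage, mem_closedBall_zero_iff]
  exact ContinuousLinearMap.opNorm_le_bound _ zero_le_two (norm_apply_le_two_mul hρ)

instance : CompactSpace (stateSpace X) := isCompact_iff_compactSpace.1 isCompact_stateSpace

instance [TopologicalSpace.SeparableSpace X] : TopologicalSpace.MetrizableSpace (stateSpace X) :=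
  WeakDual.metrizable_of_isCompact ℂ X _ isCompact_stateSpace

/-- The normalized complex extension of a real functional that is positive on the positive cone. -/
theorem exists_state_of_nonneg (f : StrongDual ℝ X) (hf : ∀ A : X, 0 ≤ f (star A * A))
    (hf1 : 0 < f 1) :
    ∃ ρ ∈ stateSpace X, ∀ a : X, IsSelfAdjoint a → ρ a = ((f 1)⁻¹ * f a : ℝ) := by
  -- Symmetrizing under `star` makes the complex extension real on self-adjoint elements.
  let g : StrongDual ℝ X :=
    ((2 * f 1)⁻¹ : ℝ) • (f + f ∘L (starL' ℝ : X ≃L[ℝ] X).toContinuousLinearMap)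
  have hg : ∀ x, g x = (2 * f 1)⁻¹ * (f x + f (star x)) := fun x => rfl
  let ρ : WeakDual ℂ X := StrongDual.toWeakDual (g.extendRCLike (𝕜 := ℂ))
  have hρ : ∀ a : X, IsSelfAdjoint a → ρ a = ((f 1)⁻¹ * f a : ℝ) := by
    intro a ha
    have h : ρ a = (g a : ℂ) - Complex.I * (g (Complex.I • a) : ℂ) :=
      StrongDual.extendRCLike_apply g a
    have h1 : g (Complex.I • a) = 0 := by
      rw [hg, star_smul, ha.star_eq, ← map_add, ← add_smul]
      simp
    have h2 : g a = (f 1)⁻¹ * f a := by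
      rw [hg, ha.star_eq]
      field_simp
      ring
    rw [h, h1, h2]
    simp
  refine ⟨ρ, ⟨fun A => ?_, ?_⟩, hρ⟩
  · rw [hρ _ (IsSelfAdjoint.star_mul_self A)]
    exact_mod_cast mul_nonneg (inv_nonneg.2 hf1.le) (hf A)
  · rw [hρ _ (IsSelfAdjoint.one X), inv_mul_cancel₀ hf1.ne', Complex.ofReal_one]

/-- A self-adjoint element on which all states vanish is zero. -/
theorem eq_zero_of_forall_state_of_isSelfAdjoint {a : X} (ha : IsSelfAdjoint a)
    (h : ∀ ρ ∈ stateSpace X, ρ a = 0) : a = 0 := by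
  let _ := CStarAlgebra.spectralOrder X
  let _ := CStarAlgebra.spectralOrderedRing X
  have key : ∀ b : X, IsSelfAdjoint b → (∀ ρ ∈ stateSpace X, ρ b = 0) → 0 ≤ b := by
    intro b hb hρ
    by_contra hneg
    -- A functional nonnegative on the positive cone but negative at `b` normalizes to a state not
    -- vanishing at `b`. If `f 1 = 0`, positivity of `b + ‖b‖` would give `f b ≥ 0`.
    obtain ⟨f, hf, hfb⟩ := ProperCone.hyperplane_separation_point (ProperCone.positive ℝ X)
      (x₀ := b) hneg
    have hf' : ∀ c : X, 0 ≤ c → 0 ≤ f c := fun c hc => hf c hc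
    have hf1 : 0 < f 1 := by
      have h1 : 0 ≤ f 1 := hf' 1 zero_le_one
      refine h1.lt_of_ne fun h0 => ?_
      have h2 := hf' _ (sub_nonneg.2 hb.neg_algebraMap_norm_le_self)
      rw [map_sub, map_neg, Algebra.algebraMap_eq_smul_one, map_smul, ← h0] at h2
      simp only [smul_zero, neg_zero, sub_zero] at h2
      linarith
    obtain ⟨ρ, hρE, hρa⟩ := exists_state_of_nonneg f (fun A => hf' _ (star_mul_self_nonneg A)) hf1
    have := hρ ρ hρE
    rw [hρa b hb, Complex.ofReal_eq_zero] at this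
    rcases mul_eq_zero.1 this with h | h
    · exact hf1.ne' (inv_eq_zero.1 h)
    · exact hfb.ne h
  refine le_antisymm (neg_nonneg.1 (key (-a) ha.neg fun ρ hρ => ?_)) (key a ha h)
  rw [map_neg, h ρ hρ, neg_zero]

/-- The states separate the points of the algebra. -/
theorem eq_zero_of_forall_state {a : X} (h : ∀ ρ ∈ stateSpace X, ρ a = 0) : a = 0 := by
  have hdec := realPart_add_I_smul_imaginaryPart a
  have hboth : ∀ ρ ∈ stateSpace X, ρ (realPart a : X) = 0 ∧ ρ (imaginaryPart a : X) = 0 := by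
    intro ρ hρ
    have h0 := h ρ hρ
    rw [← hdec, map_add, map_smul, smul_eq_mul] at h0
    have hr := (im_eq_zero_and_abs_re_le_of_isSelfAdjoint hρ (realPart a).2).1
    have hi := (im_eq_zero_and_abs_re_le_of_isSelfAdjoint hρ (imaginaryPart a).2).1
    have hre := congrArg Complex.re h0
    have him' := congrArg Complex.im h0
    simp only [Complex.add_re, Complex.add_im, Complex.mul_re, Complex.mul_im, Complex.I_re,
      Complex.I_im, Complex.zero_re, Complex.zero_im, hr, hi, zero_mul, one_mul, mul_zero, sub_zero,
      add_zero, zero_add] at hre him'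
    exact ⟨Complex.ext hre hr, Complex.ext him' hi⟩
  rw [← hdec, eq_zero_of_forall_state_of_isSelfAdjoint (realPart a).2 fun ρ hρ => (hboth ρ hρ).1,
    eq_zero_of_forall_state_of_isSelfAdjoint (imaginaryPart a).2 fun ρ hρ => (hboth ρ hρ).2]
  simp

/-- The state space of an infinite-dimensional algebra is not spanned by a finite set. -/
theorem exists_state_notMem_span (hdim : ¬ FiniteDimensional ℂ X) {t : Set (WeakDual ℂ X)}
    (ht : t.Finite) : ∃ ρ ∈ stateSpace X, ρ ∉ Submodule.span ℝ t := by
  by_contra! hcon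
  have := ht.to_subtype
  -- If `t` spanned all states, evaluation on `t` would embed the algebra in a finite-dimensional
  -- space.
  let Φ : X →ₗ[ℂ] (t → ℂ) := LinearMap.pi fun σ => (WeakDual.toStrongDual σ.1).toLinearMap
  refine hdim (FiniteDimensional.of_injective Φ ((injective_iff_map_eq_zero Φ).2 fun a ha => ?_))
  refine eq_zero_of_forall_state fun ρ hρ => ?_
  refine Submodule.span_induction (p := fun σ _ => σ a = 0) ?_ ?_ ?_ ?_ (hcon ρ hρ)
  · intro σ hσ
    exact congrFun ha ⟨σ, hσ⟩
  · rfl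
  · intro σ τ _ _ hσ hτ
    change σ a + τ a = 0
    rw [hσ, hτ, add_zero]
  · intro r σ _ hσ
    change r • σ a = 0
    rw [hσ, smul_zero]

end StateSpace

/-! ### The hypertopology and the closed-hull map. -/

open TopologicalSpace (NonemptyCompacts)

namespace ConvexWeakStarCompacts

variable {X : Type*} [CStarAlgebra X]

theorem topology_eq_iInf_induced :
    (inferInstance : TopologicalSpace (ConvexWeakStarCompacts X)) =
      ⨅ A : X, TopologicalSpace.induced (evalImage A) inferInstance := by
  refine iInf_congr fun A => ?_
  have h : @Isometry _ _ (pseudoMetric A).toPseudoEMetricSpace _ (evalImage (X := X) A) :=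
    @Isometry.of_dist_eq _ _ (pseudoMetric A) _ _ fun K L => (pseudoDist_eq A K L).symm
  exact @Topology.IsInducing.eq_induced _ _ (_) _ _
    (@IsUniformInducing.isInducing _ _ (_) _ _ (@Isometry.isUniformInducing _ _ (_) _ _ h))

theorem continuous_evalImage (A : X) :
    Continuous (evalImage A : ConvexWeakStarCompacts X → NonemptyCompacts ℂ) := by
  rw [continuous_iff_le_induced]
  exact topology_eq_iInf_induced.le.trans (iInf_le _ A)

theorem continuous_iff_evalImage {Y : Type*} [TopologicalSpace Y]
    {f : Y → ConvexWeakStarCompacts X} :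
    Continuous f ↔ ∀ A : X, Continuous fun y => evalImage A (f y) := by
  refine ⟨fun h A => (continuous_evalImage A).comp h, fun h => ?_⟩
  have h2 : @Continuous _ _ _ (⨅ A : X, TopologicalSpace.induced (evalImage A) inferInstance) f :=
    continuous_iInf_rng.2 fun A => continuous_induced_rng.2 (h A)
  rwa [← topology_eq_iInf_induced] at h2

theorem ext_carrier {K L : ConvexWeakStarCompacts X} (h : K.carrier = L.carrier) : K = L := by
  cases K; cases L; congr

end ConvexWeakStarCompacts

section Hull

variable {X : Type*} [CStarAlgebra X]

open ConvexWeakStarCompacts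

/-- Membership of a state in a convex weak⋆-compact set of states is tested on a dense set. -/
theorem mem_carrier_of_dense {S : Set X} (hS : Dense S) {K : ConvexWeakStarCompacts X}
    (hK : K.carrier ⊆ stateSpace X) {ρ : WeakDual ℂ X} (hρ : ρ ∈ stateSpace X)
    (h : ∀ A ∈ S, ρ A ∈ evalImage A K) : ρ ∈ K.carrier := by
  by_contra hn
  obtain ⟨A, u, h1, h2⟩ := WeakDual.exists_re_lt_of_notMem K.convex K.isCompact.isClosed hn
  obtain ⟨τ, hτ, hmax⟩ := K.isCompact.exists_isMaxOn K.nonempty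
    (Complex.continuous_re.comp (WeakDual.eval_continuous A)).continuousOn
  -- Passing from `A` to `B` costs at most `2‖A - B‖` for each of `σ` and `ρ`, whence the divisor 4.
  obtain ⟨B, hB, hAB⟩ := hS.exists_dist_lt A (ε := ((ρ A).re - u) / 4) (by linarith)
  rw [dist_eq_norm] at hAB
  obtain ⟨σ, hσ, hσB⟩ := h B hB
  have e1 : ‖σ A - σ B‖ ≤ 2 * ‖A - B‖ := by
    rw [← map_sub]; exact norm_apply_le_two_mul (hK hσ) _
  have e2 : ‖ρ A - ρ B‖ ≤ 2 * ‖A - B‖ := by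
    rw [← map_sub]; exact norm_apply_le_two_mul hρ _
  have r1 := (abs_le.1 ((Complex.abs_re_le_norm _).trans e1)).1
  have r2 := (abs_le.1 ((Complex.abs_re_le_norm _).trans e2)).2
  have hσB' : σ B = ρ B := hσB
  rw [Complex.sub_re] at r1 r2
  rw [hσB'] at r1
  linarith [h1 σ hσ]

theorem stateCompacts_ext_of_dense {S : Set X} (hS : Dense S) {K L : StateCompacts X}
    (h : ∀ A ∈ S, evalImage A K.1 = evalImage A L.1) : K = L := by
  refine Subtype.ext (ext_carrier (Subset.antisymm (fun ρ hρ => ?_) fun ρ hρ => ?_))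
  · exact mem_carrier_of_dense hS L.2 (K.2 hρ) fun A hA => h A hA ▸ ⟨ρ, hρ, rfl⟩
  · exact mem_carrier_of_dense hS K.2 (L.2 hρ) fun A hA => h A hA ▸ ⟨ρ, hρ, rfl⟩

theorem closure_convexHull_coe_subset (F : Set (stateSpace X)) :
    closure (convexHull ℝ (Subtype.val '' F)) ⊆ stateSpace X :=
  closure_minimal (convexHull_min (image_subset_iff.2 fun ρ _ => ρ.2) convex_stateSpace)
    isClosed_stateSpace

theorem isCompact_closure_convexHull_coe (F : Set (stateSpace X)) :
    IsCompact (closure (convexHull ℝ (Subtype.val '' F))) :=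
  isCompact_stateSpace.of_isClosed_subset isClosed_closure (closure_convexHull_coe_subset F)

theorem convex_closure_convexHull_coe (F : Set (stateSpace X)) :
    Convex ℝ (closure (convexHull ℝ (Subtype.val '' F))) :=
  (convex_convexHull ℝ _).closure

/-- The weak⋆-closed convex hull of a nonempty compact set of states. -/
noncomputable def stateHull (F : NonemptyCompacts (stateSpace X)) : StateCompacts X where
  val.carrier := closure (convexHull ℝ (Subtype.val '' (F : Set (stateSpace X))))
  val.nonempty := (convexHull_nonempty_iff.2 (F.nonempty.image _)).closure
  val.convex := convex_closure_convexHull_coe (F : Set (stateSpace X))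
  val.isCompact := isCompact_closure_convexHull_coe (F : Set (stateSpace X))
  property := closure_convexHull_coe_subset (F : Set (stateSpace X))

theorem stateHull_carrier (F : NonemptyCompacts (stateSpace X)) :
    (stateHull F).1.carrier = closure (convexHull ℝ (Subtype.val '' (F : Set (stateSpace X)))) := rfl

theorem continuous_stateEval (A : X) : Continuous fun ρ : stateSpace X => ρ.1 A :=
  (WeakDual.eval_continuous A).comp continuous_subtype_val

/-- Evaluation is real-linear, and its image commutes with the closure because that closure is
compact. -/
theorem evalImage_stateHull (A : X) (F : NonemptyCompacts (stateSpace X)) :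
    evalImage A (stateHull F).1 =
      (F.map (fun ρ => ρ.1 A) (continuous_stateEval A)).closedHull := by
  refine SetLike.coe_injective ?_
  change (fun σ : WeakDual ℂ X => σ A) '' closure (convexHull ℝ (Subtype.val '' (F : Set (stateSpace X))))
    = closure (convexHull ℝ ((fun ρ : stateSpace X => ρ.1 A) '' (F : Set (stateSpace X))))
  let ev : WeakDual ℂ X →ₗ[ℝ] ℂ :=
    { toFun := fun σ => σ A, map_add' := fun _ _ => rfl, map_smul' := fun _ _ => rfl }
  have h := ev.image_convexHull (Subtype.val '' (F : Set (stateSpace X)))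
  rw [image_image] at h
  change (fun σ : WeakDual ℂ X => σ A) '' (convexHull ℝ _) =
    convexHull ℝ ((fun ρ : stateSpace X => ρ.1 A) '' (F : Set (stateSpace X))) at h
  rw [← h, image_closure_of_isCompact (stateHull F).1.isCompact
    (WeakDual.eval_continuous A).continuousOn]

theorem continuous_stateHull :
    Continuous (stateHull : NonemptyCompacts (stateSpace X) → StateCompacts X) := by
  refine continuous_induced_rng.2 (continuous_iff_evalImage.2 fun A => ?_)
  have := NonemptyCompacts.lipschitzWith_closedHull.continuous.comp
    (continuous_stateEval A).nonemptyCompacts_map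
  exact this.congr fun F => (evalImage_stateHull A F).symm

/-- A convex compact set of states as a compact subset of the state space. -/
def StateCompacts.toNonemptyCompacts (K : StateCompacts X) : NonemptyCompacts (stateSpace X) where
  carrier := Subtype.val ⁻¹' K.1.carrier
  isCompact' := Topology.IsClosedEmbedding.isCompact_preimage
    isClosed_stateSpace.isClosedEmbedding_subtypeVal K.1.isCompact
  nonempty' := let ⟨ρ, hρ⟩ := K.1.nonempty; ⟨⟨ρ, K.2 hρ⟩, mem_preimage.2 hρ⟩

theorem StateCompacts.image_toNonemptyCompacts (K : StateCompacts X) :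
    Subtype.val '' (K.toNonemptyCompacts : Set (stateSpace X)) = K.1.carrier :=
  Subset.antisymm (image_subset_iff.2 fun _ h => h) fun ρ hρ => ⟨⟨ρ, K.2 hρ⟩, hρ, rfl⟩

theorem stateHull_toNonemptyCompacts (K : StateCompacts X) :
    stateHull K.toNonemptyCompacts = K := by
  refine Subtype.ext (ext_carrier ?_)
  rw [stateHull_carrier, K.image_toNonemptyCompacts, K.1.convex.convexHull_eq,
    K.1.isCompact.isClosed.closure_eq]

/-- The extreme points of the hull of a compact set of states belong to that set. -/
theorem mem_of_mem_extremePoints_stateHull {F : NonemptyCompacts (stateSpace X)}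
    {ρ : stateSpace X} (hρ : ρ.1 ∈ (stateHull F).1.carrier.extremePoints ℝ) : ρ ∈ F := by
  have := extremePoints_closure_convexHull_subset (F.isCompact.image continuous_subtype_val)
    (stateHull F).1.isCompact hρ
  obtain ⟨σ, hσ, h⟩ := this
  rwa [← Subtype.ext h]

/-- The weak⋆-closure of the set of extreme points of a convex compact set of states. -/
def StateCompacts.extremeClosure (K : StateCompacts X) : NonemptyCompacts (stateSpace X) where
  carrier := Subtype.val ⁻¹' closure (K.1.carrier.extremePoints ℝ)
  isCompact' := (isClosed_closure.preimage continuous_subtype_val).isCompact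
  nonempty' :=
    let ⟨ρ, hρ⟩ := K.1.isCompact.extremePoints_nonempty K.1.nonempty
    ⟨⟨ρ, K.2 (extremePoints_subset hρ)⟩, mem_preimage.2 (subset_closure hρ)⟩

/-- This is Krein–Milman; `K.extremeClosure` is the compact generating set used to test membership
in `denseExtremeBoundary`. -/
theorem stateHull_extremeClosure (K : StateCompacts X) : stateHull K.extremeClosure = K := by
  refine Subtype.ext (ext_carrier ?_)
  have hsub : closure (K.1.carrier.extremePoints ℝ) ⊆ K.1.carrier :=
    closure_minimal extremePoints_subset K.1.isCompact.isClosed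
  have himg : Subtype.val '' (K.extremeClosure : Set (stateSpace X)) =
      closure (K.1.carrier.extremePoints ℝ) :=
    Subset.antisymm (image_subset_iff.2 fun _ h => h)
      fun ρ hρ => ⟨⟨ρ, K.2 (hsub hρ)⟩, hρ, rfl⟩
  rw [stateHull_carrier, himg]
  refine Subset.antisymm
    (closure_minimal (convexHull_min hsub K.1.convex) K.1.isCompact.isClosed) ?_
  conv_lhs => rw [← closure_convexHull_extremePoints K.1.isCompact K.1.convex]
  exact closure_mono (convexHull_mono subset_closure)

end Hull

/-! ### Compactness, metrizability and the embedding of points. -/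

section Topology

variable {X : Type*} [CStarAlgebra X]

open ConvexWeakStarCompacts

instance : CompactSpace (StateCompacts X) where
  isCompact_univ := by
    rw [← (show Function.Surjective (stateHull (X := X)) from
      fun K => ⟨_, stateHull_toNonemptyCompacts K⟩).range_eq]
    exact isCompact_range continuous_stateHull

instance : T2Space (StateCompacts X) := by
  refine T2Space.of_injective_continuous
    (f := fun (K : StateCompacts X) (A : X) => evalImage A K.1) (fun K L h => ?_) ?_
  · exact stateCompacts_ext_of_dense dense_univ fun A _ => congrFun h A
  · exact continuous_pi fun A => (continuous_evalImage A).comp continuous_subtype_val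

instance [TopologicalSpace.SeparableSpace X] :
    TopologicalSpace.MetrizableSpace (StateCompacts X) := by
  have hcont : Continuous fun (K : StateCompacts X) (n : ℕ) =>
      evalImage (TopologicalSpace.denseSeq X n) K.1 :=
    continuous_pi fun n => (continuous_evalImage _).comp continuous_subtype_val
  -- A continuous injection of a compact space into a Hausdorff space is an embedding.
  refine (hcont.isClosedEmbedding fun K L h => ?_).isEmbedding.metrizableSpace
  refine stateCompacts_ext_of_dense (TopologicalSpace.denseRange_denseSeq X) ?_
  rintro _ ⟨n, rfl⟩
  exact congrFun h n

theorem isCompletelyMetrizableSpace_of_compactSpace (Y : Type*) [TopologicalSpace Y]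
    [CompactSpace Y] [TopologicalSpace.MetrizableSpace Y] :
    TopologicalSpace.IsCompletelyMetrizableSpace Y := by
  let _ := TopologicalSpace.metrizableSpaceMetric Y
  infer_instance

theorem isEmbedding_singletonState : Topology.IsEmbedding (singletonState X) := by
  have hcont : Continuous (singletonState X) := by
    refine continuous_induced_rng.2 (continuous_iff_evalImage.2 fun A => ?_)
    have := NonemptyCompacts.continuous_singleton.comp (continuous_stateEval A)
    refine this.congr fun ρ => SetLike.coe_injective ?_
    change {ρ.1 A} = (fun σ : WeakDual ℂ X => σ A) '' {ρ.1}
    rw [image_singleton]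
  refine (hcont.isClosedEmbedding fun ρ σ h => Subtype.ext ?_).isEmbedding
  exact singleton_injective (congrArg (fun K : StateCompacts X => K.1.carrier) h)

/-- The incidence relation between states and convex compact sets of states is closed. -/
theorem isClosed_setOf_mem_carrier :
    IsClosed {p : stateSpace X × StateCompacts X | p.1.1 ∈ p.2.1.carrier} := by
  -- By Hahn–Banach, membership is tested by all evaluations, and each test is the vanishing of a
  -- jointly continuous distance.
  have : {p : stateSpace X × StateCompacts X | p.1.1 ∈ p.2.1.carrier} =
      ⋂ A : X, {p | Metric.infDist (p.1.1 A) (evalImage A p.2.1 : Set ℂ) = 0} := by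
    ext p
    simp only [mem_iInter, mem_ofPred_eq]
    have h : ∀ A : X, Metric.infDist (p.1.1 A) (evalImage A p.2.1 : Set ℂ) = 0 ↔
        p.1.1 A ∈ evalImage A p.2.1 := fun A =>
      ((evalImage A p.2.1).isCompact.isClosed.mem_iff_infDist_zero
        (evalImage A p.2.1).nonempty).symm
    simp only [h]
    exact ⟨fun hp A => ⟨p.1.1, hp, rfl⟩,
      fun hp => mem_carrier_of_dense dense_univ p.2.2 p.1.2 fun A _ => hp A⟩
  rw [this]
  refine isClosed_iInter fun A => isClosed_eq ?_ continuous_const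
  have h1 : Continuous fun q : ℂ × NonemptyCompacts ℂ => Metric.infDist q.1 (q.2 : Set ℂ) :=
    Metric.lipschitz_infDist.continuous
  have h2 : Continuous fun p : stateSpace X × StateCompacts X => p.1.1 A :=
    (continuous_stateEval A).comp continuous_fst
  have h3 : Continuous fun p : stateSpace X × StateCompacts X => evalImage A p.2.1 :=
    (continuous_evalImage A).comp (continuous_subtype_val.comp continuous_snd)
  have h4 : Continuous fun p : stateSpace X × StateCompacts X => (p.1.1 A, evalImage A p.2.1) :=
    h2.prodMk h3
  have h5 := h1.comp h4
  exact h5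

end Topology

/-- A continuous distance function to the nonempty compact subsets of a metrizable space. -/
theorem exists_continuous_dist_nonemptyCompacts (Y : Type*) [TopologicalSpace Y]
    [TopologicalSpace.MetrizableSpace Y] :
    ∃ g : Y × NonemptyCompacts Y → ℝ, Continuous g ∧ (∀ p, g p ≤ 0 ↔ p.1 ∈ p.2) ∧
      ∀ y F G, F ≤ G → g (y, G) ≤ g (y, F) := by
  let _ := TopologicalSpace.metrizableSpaceMetric Y
  refine ⟨fun p => Metric.infDist p.1 (p.2 : Set Y), Metric.lipschitz_infDist.continuous, ?_, ?_⟩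
  · intro p
    rw [← SetLike.mem_coe, p.2.isCompact.isClosed.mem_iff_infDist_zero p.2.nonempty]
    exact ⟨fun h => h.antisymm Metric.infDist_nonneg, fun h => h.le⟩
  · intro y F G h
    exact Metric.infDist_le_infDist_of_subset h F.nonempty

/-! ### The `Gδ` property and density. -/

section Density

variable {X : Type*} [CStarAlgebra X]

/-- Every state is a limit of states outside a proper subspace. -/
theorem dense_notMem_span {t : Set (WeakDual ℂ X)} {ρ : WeakDual ℂ X} (hρ : ρ ∈ stateSpace X)
    (hρt : ρ ∉ Submodule.span ℝ t) :
    Dense {σ : stateSpace X | σ.1 ∉ Submodule.span ℝ t} := by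
  rw [Subtype.dense_iff]
  intro σ hσ
  by_cases hσt : σ ∈ Submodule.span ℝ t
  · have hsub : openSegment ℝ σ ρ ⊆
        Subtype.val '' {σ : stateSpace X | σ.1 ∉ Submodule.span ℝ t} := by
      rintro τ ⟨a, b, ha, hb, hab, rfl⟩
      refine ⟨⟨_, convex_stateSpace hσ hρ ha.le hb.le hab⟩, ?_, rfl⟩
      intro h
      have h1 : b • ρ ∈ Submodule.span ℝ t :=
        (Submodule.add_mem_iff_right _ (Submodule.smul_mem _ a hσt)).1 h
      exact hρt ((Submodule.smul_mem_iff _ hb.ne').1 h1)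
    refine closure_mono hsub ?_
    rw [closure_openSegment]
    exact left_mem_segment ℝ σ ρ
  · exact subset_closure ⟨⟨σ, hσ⟩, hσt, rfl⟩

variable (X) in
/-- The finite, linearly independent sets of states. -/
def independentFiniteStates : Set (NonemptyCompacts (stateSpace X)) :=
  {F | (F : Set (stateSpace X)).Finite ∧
    LinearIndepOn ℝ id (Subtype.val '' (F : Set (stateSpace X)))}

theorem singleton_mem_independentFiniteStates (ρ : stateSpace X) :
    ({ρ} : NonemptyCompacts (stateSpace X)) ∈ independentFiniteStates X := by
  refine ⟨by simp, ?_⟩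
  rw [NonemptyCompacts.coe_singleton, image_singleton]
  refine LinearIndepOn.singleton fun h => ?_
  have h1 := ρ.2.2
  rw [show ρ.1 = 0 from h] at h1
  exact zero_ne_one h1

/-- The added point can be moved slightly out of the span of `F`, which keeps independence. -/
theorem sup_singleton_mem_closure_independentFiniteStates (hdim : ¬ FiniteDimensional ℂ X)
    {F : NonemptyCompacts (stateSpace X)} (hF : F ∈ independentFiniteStates X)
    (ρ : stateSpace X) : F ⊔ {ρ} ∈ closure (independentFiniteStates X) := by
  obtain ⟨σ, hσ, hσF⟩ := exists_state_notMem_span hdim (hF.1.image Subtype.val)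
  have hcont : Continuous fun τ : stateSpace X => F ⊔ {τ} :=
    continuous_const.sup NonemptyCompacts.continuous_singleton
  refine map_mem_closure (f := fun τ => F ⊔ {τ}) hcont (dense_notMem_span hσ hσF ρ) fun τ hτ => ?_
  have hcoe : ((F ⊔ {τ} : NonemptyCompacts (stateSpace X)) : Set (stateSpace X)) =
      insert τ (F : Set (stateSpace X)) := by
    rw [NonemptyCompacts.coe_sup, NonemptyCompacts.coe_singleton, union_singleton]
  refine ⟨hcoe ▸ hF.1.insert τ, ?_⟩
  rw [hcoe, image_insert_eq]
  exact hF.2.id_insert hτ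

theorem dense_independentFiniteStates (hdim : ¬ FiniteDimensional ℂ X) :
    Dense (independentFiniteStates X) := by
  rw [← dense_closure]
  refine NonemptyCompacts.dense_setOfPred_finite.mono ?_
  have key : ∀ s : Set (stateSpace X), s.Finite → ∀ F : NonemptyCompacts (stateSpace X),
      (F : Set (stateSpace X)) = s → F ∈ closure (independentFiniteStates X) := by
    intro s hs
    induction s, hs using Set.Finite.induction_on with
    | empty => exact fun F hF => absurd hF F.nonempty.ne_empty
    | @insert ρ s _ hs ih =>
      intro F hF
      rcases s.eq_empty_or_nonempty with rfl | hne
      · have : F = {ρ} := SetLike.coe_injective (by simp [hF])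
        exact this ▸ subset_closure (singleton_mem_independentFiniteStates ρ)
      · have hG := ih ⟨⟨s, hs.isCompact⟩, hne⟩ rfl
        have hFG : F = (⟨⟨s, hs.isCompact⟩, hne⟩ : NonemptyCompacts (stateSpace X)) ⊔ {ρ} := by
          refine SetLike.coe_injective ?_
          rw [NonemptyCompacts.coe_sup, NonemptyCompacts.coe_singleton, union_singleton, hF]
          rfl
        have hcont : Continuous fun G : NonemptyCompacts (stateSpace X) => G ⊔ {ρ} :=
          continuous_id.sup continuous_const
        rw [hFG, ← closure_closure]
        exact map_mem_closure (f := fun G => G ⊔ {ρ}) hcont hG fun G hG' =>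
          sup_singleton_mem_closure_independentFiniteStates hdim hG' ρ
  exact fun F hF => key _ hF F rfl

/-- Independent points are extreme in their hull, and by Milman every compact generating set
contains the extreme points. -/
theorem le_of_stateHull_eq {F G : NonemptyCompacts (stateSpace X)}
    (hF : F ∈ independentFiniteStates X) (h : stateHull G = stateHull F) : F ≤ G := by
  intro ρ hρ
  refine mem_of_mem_extremePoints_stateHull ?_
  have hfin := hF.1.image Subtype.val
  rw [h, stateHull_carrier, (hfin.isClosed_convexHull ℝ).closure_eq]
  exact hF.2.subset_extremePoints_convexHull hfin ⟨ρ, hρ, rfl⟩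

/-- The hulls of compact sets from which some point of the hull has distance at least `r`. -/
def farHulls (g : stateSpace X × NonemptyCompacts (stateSpace X) → ℝ) (r : ℝ) :
    Set (StateCompacts X) :=
  (fun p => stateHull p.2) '' {p | p.1.1 ∈ (stateHull p.2).1.carrier ∧ r ≤ g p}

theorem isClosed_setOf_mem_stateHull
    {g : stateSpace X × NonemptyCompacts (stateSpace X) → ℝ} (hg : Continuous g) (r : ℝ) :
    IsClosed {p : stateSpace X × NonemptyCompacts (stateSpace X) |
      p.1.1 ∈ (stateHull p.2).1.carrier ∧ r ≤ g p} := by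
  have h1 : Continuous fun p : stateSpace X × NonemptyCompacts (stateSpace X) =>
      (p.1, stateHull p.2) := continuous_fst.prodMk (continuous_stateHull.comp continuous_snd)
  exact (isClosed_setOf_mem_carrier.preimage h1).inter (isClosed_le continuous_const hg)

theorem isClosed_farHulls
    {g : stateSpace X × NonemptyCompacts (stateSpace X) → ℝ} (hg : Continuous g) (r : ℝ) :
    IsClosed (farHulls g r) :=
  ((isClosed_setOf_mem_stateHull hg r).isCompact.image
    (continuous_stateHull.comp continuous_snd)).isClosed

theorem dense_compl_farHulls (hdim : ¬ FiniteDimensional ℂ X)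
    {g : stateSpace X × NonemptyCompacts (stateSpace X) → ℝ} (hg : Continuous g)
    (hg0 : ∀ p, g p ≤ 0 ↔ p.1 ∈ p.2) (hgm : ∀ y F G, F ≤ G → g (y, G) ≤ g (y, F))
    {r : ℝ} (hr : 0 < r) : Dense (farHulls g r)ᶜ := by
  -- `W` consists of the compact sets lying within `r` of every point of their hull. It is open, and
  -- it contains each convex `K` because `K` is its own hull.
  let W : Set (NonemptyCompacts (stateSpace X)) :=
    (Prod.snd '' {p | p.1.1 ∈ (stateHull p.2).1.carrier ∧ r ≤ g p})ᶜ
  have hW : IsOpen W :=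
    ((isClosed_setOf_mem_stateHull hg r).isCompact.image continuous_snd).isClosed.isOpen_compl
  rw [dense_iff_inter_open]
  rintro U hU ⟨K, hK⟩
  have hKW : K.toNonemptyCompacts ∈ W := by
    rintro ⟨⟨ρ, F⟩, ⟨h1, h2⟩, rfl⟩
    rw [stateHull_toNonemptyCompacts] at h1
    exact (hr.trans_le h2).not_ge ((hg0 _).2 h1)
  obtain ⟨F, ⟨hFW, hFU⟩, hF⟩ := (dense_independentFiniteStates hdim).inter_open_nonempty
    (W ∩ stateHull ⁻¹' U) (hW.inter (hU.preimage continuous_stateHull))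
    ⟨K.toNonemptyCompacts, hKW, by rwa [mem_preimage, stateHull_toNonemptyCompacts]⟩
  refine ⟨stateHull F, hFU, ?_⟩
  rintro ⟨⟨ρ, G⟩, ⟨h1, h2⟩, hGF⟩
  change stateHull G = stateHull F at hGF
  refine hFW ⟨(ρ, F), ⟨?_, h2.trans (hgm ρ F G (le_of_stateHull_eq hF hGF))⟩, rfl⟩
  rwa [← hGF]

theorem denseExtremeBoundary_eq_iInter
    {g : stateSpace X × NonemptyCompacts (stateSpace X) → ℝ}
    (hg0 : ∀ p, g p ≤ 0 ↔ p.1 ∈ p.2) :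
    denseExtremeBoundary X = ⋂ n : ℕ, (farHulls g (1 / ((n : ℝ) + 1)))ᶜ := by
  ext K
  simp only [mem_iInter]
  constructor
  · rintro hK n ⟨⟨ρ, F⟩, ⟨h1, h2⟩, rfl⟩
    have hsub : closure ((stateHull F).1.carrier.extremePoints ℝ) ⊆
        Subtype.val '' (F : Set (stateSpace X)) :=
      closure_minimal (fun σ hσ => ⟨⟨σ, (stateHull F).2 (extremePoints_subset hσ)⟩,
        mem_of_mem_extremePoints_stateHull hσ, rfl⟩)
        (F.isCompact.image continuous_subtype_val).isClosed
    have hK' : (stateHull F).1.carrier = closure ((stateHull F).1.carrier.extremePoints ℝ) := hK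
    rw [hK'] at h1
    obtain ⟨σ, hσ, hσρ⟩ := hsub h1
    have hρ : ρ ∈ F := (Subtype.ext hσρ : σ = ρ) ▸ hσ
    have := (hg0 (ρ, F)).2 hρ
    have hn : (0 : ℝ) < 1 / ((n : ℝ) + 1) := Nat.one_div_pos_of_nat
    linarith
  · intro h
    refine Subset.antisymm (fun ρ hρ => ?_)
      (closure_minimal extremePoints_subset K.1.isCompact.isClosed)
    -- Otherwise `K.extremeClosure`, whose hull is `K`, would witness that `K` is in some
    -- `farHulls`.
    have hle : g (⟨ρ, K.2 hρ⟩, K.extremeClosure) ≤ 0 := by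
      by_contra! hpos
      obtain ⟨n, hn⟩ := exists_nat_one_div_lt hpos
      refine h n ⟨(⟨ρ, K.2 hρ⟩, K.extremeClosure), ⟨?_, hn.le⟩, stateHull_extremeClosure K⟩
      rw [stateHull_extremeClosure]
      exact hρ
    exact (hg0 _).1 hle

end Density

theorem mainTheorem4 (X : Type*) [CStarAlgebra X] [TopologicalSpace.SeparableSpace X]
    (hdim : ¬ FiniteDimensional ℂ X) :
    CompactSpace (StateCompacts X) ∧
      TopologicalSpace.IsCompletelyMetrizableSpace (StateCompacts X) ∧
      Topology.IsEmbedding (singletonState X) ∧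
      IsGδ (denseExtremeBoundary X) ∧
      Dense (denseExtremeBoundary X) := by
  obtain ⟨g, hg, hg0, hgm⟩ := exists_continuous_dist_nonemptyCompacts (stateSpace X)
  refine ⟨inferInstance, isCompletelyMetrizableSpace_of_compactSpace _,
    isEmbedding_singletonState, ?_, ?_⟩
  · rw [denseExtremeBoundary_eq_iInter hg0]
    exact .iInter_of_isOpen fun n => (isClosed_farHulls hg _).isOpen_compl
  · rw [denseExtremeBoundary_eq_iInter hg0]
    exact dense_iInter_of_isOpen_nat (fun n => (isClosed_farHulls hg _).isOpen_compl)
      fun n => dense_compl_farHulls hdim hg hg0 hgm Nat.one_div_pos_of_nat
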